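/- **Model.** There are $n=3f+1$ processes ($f\ge 0$), at most $f$ of them Byzantine, the others correct, communicating over authenticated point-to-point links. There are an unknown time $\mathsf{GST}\ge 0$ and an unknown bound $\delta>0$ such that every message sent at or after $\mathsf{GST}$ by a correct process to a correct process is received within $\delta$; messages sent before $\mathsf{GST}$ may be lost or arbitrarily delayed. A message sent to oneself is received immediately. Each process has a monotone local clock, which advances at the rate of real time from $\mathsf{GST}$ on and is otherwise arbitrary before $\mathsf{GST}$. Handling an event takes no time, and finitely many events happen in bounded time; the events of an execution are totally ordered, compatibly with their times, and simultaneous events are allowed. Each correct process calls $\mathtt{start}()$ once. **Protocol FastSync.** Its parameters are a retransmission period $\rho>0$ and a non-decreasing function $F:\mathbb N\to\mathbb R$ with $F(0)=0$ and $\forall\theta\,\exists v\,\forall v'\ge v:\ F(v')>\theta$; it knows neither $\mathsf{GST}$ nor $\delta$. Process $p_i$ keeps an array $\mathit{max\_views}[1..n]$ and variables $\mathit{view},\mathit{view}^+$, all initially $0$, and a timer, initially disabled. It runs the following code. * On $\mathtt{start}()$: if $\mathit{view}^+=0$, send $\mathtt{WISH}(1)$ to all. * When the timer expires: send $\mathtt{WISH}(\max(\mathit{view}+1,\mathit{view}^+))$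 to all. * Every $\rho$ units of local time: if the timer is enabled, send $\mathtt{WISH}(\mathit{view}^+)$ to all; otherwise, if $\mathit{max\_views}[i]>0$, send $\mathtt{WISH}(\max(\mathit{view}+1,\mathit{view}^+))$ to all. * On receiving $\mathtt{WISH}(v)$ from $p_j$: set $\mathit{max\_views}[j]$ to $\max(\mathit{max\_views}[j],v)$; set $\mathit{view}$ (respectively $\mathit{view}^+$) to the largest entry $u$ of $\mathit{max\_views}$ such that at least $2f+1$ (respectively $f+1$) entries are $\ge u$. If now $\mathit{view}^+=\mathit{view}$ and $\mathit{view}$ has increased, restart the timer for $F(\mathit{view})$ units of local time and *enter* the view $\mathit{view}$. If $\mathit{view}^+$ has increased, send $\mathtt{WISH}(\mathit{view}^+)$ to all. **Notation.** $t_{\rm first}(v)$ and $t_{\rm last}(v)$ are the times at which the first and the last correct process enters $v$; $\mathsf{GV}(t)$ is the highest view entered by a correct process at or before time $t$ ($0$ if there is none); $S_{\rm first}$, $S_{\rm last}$ and $S_{f+1}$ are the times of the first, the last and the $(f+1)$-st call to $\mathtt{start}()$ by correct processes. The synchronizer specification with parameters $d$ and $\mathcal V\ge 1$ says: 1. every correct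 process enters views in strictly increasing order, each at most once (so at non-decreasing times; at strictly increasing times if that process handles no two events, other than receptions of its own messages, at the same time); 2. $t_{\rm first}(\mathcal V)\ge \mathsf{GST}$; 3. every correct process enters every view $v\ge\mathcal V$; 4. $t_{\rm last}(v)\le t_{\rm first}(v)+d$ for all $v\ge\mathcal V$; 5. $t_{\rm first}(v+1)\ge t_{\rm first}(v)+F(v)$ for all $v\ge\mathcal V$. **Theorem.** In every execution of FastSync the following hold. (a) The synchronizer specification holds with $d=2\delta$ for some view $\mathcal V$. (b) If $S_{\rm first}\ge\mathsf{GST}$ and $F(1)>2\delta$, then the specification holds with $d=2\delta$ and $\mathcal V=1$; moreover $t_{\rm last}(v+1)\le t_{\rm last}(v)+F(v)+\delta$ for all $v\ge 1$, and $t_{\rm last}(1)\le S_{\rm last}+\delta$. (c) Let $\mathcal V=\mathsf{GV}(\mathsf{GST}+\rho)+1$. If $S_{f+1}\le\mathsf{GST}+\rho$ and $F(\mathcal V)>2\delta$, then the specification holds with $d=2\delta$ and this $\mathcal V$; moreover $t_{\rm last}(v+1)\le t_{\rm last}(v)+F(v)+\delta$ for all $v\ge\mathcal V$, and $t_{\rm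 last}(\mathcal V)\le\mathsf{GST}+\rho+F(\mathsf{GV}(\mathsf{GST}+\rho))+3\delta$. -/

import Mathlib

namespace FastSync

/-! ## The protocol, as executed by a single process

There are `3 * f + 1` processes. Views are positive naturals, `0` standing for "no view". The only
message is `WISH(v)`, identified with the natural number `v`; it is always sent to all processes.
The protocol code has access to the local clock, to the timeout function `F` and to the
retransmission period `ρ`, but not to real time, to `GST` or to `δ`. -/

/-- The events that a process reacts to. -/
inductive Act (f : ℕ) where
  /-- the application calls `start()` -/
  | start : Act f
  /-- the timer `timer_view` expires -/
  | expire : Act f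
  /-- the periodic retransmission code runs -/
  | retransmit : Act f
  /-- a message `WISH(v)` is received from process `j` -/
  | recv (j : Fin (3 * f + 1)) (v : ℕ) : Act f

/-- The local state of a process. -/
structure LocalState (f : ℕ) where
  /-- `max_views[j]` is the highest view received in a `WISH` message from `j` (initially `0`) -/
  maxViews : Fin (3 * f + 1) → ℕ
  /-- the variable `view` -/
  view : ℕ
  /-- the variable `view⁺` -/
  viewPlus : ℕ
  /-- `timer_view`: `none` if disabled, `some D` if set to expire at local clock reading `D` -/
  timer : Option ℝ
  /-- the local clock reading at which the periodic retransmission code has to run next -/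
  nextRetransmit : ℝ

/-- The effect of executing one handler. -/
structure Outcome (f : ℕ) where
  /-- the new local state -/
  post : LocalState f
  /-- `some v` if `WISH(v)` is sent to all processes -/
  wish : Option ℕ
  /-- `some v` if `new_view(v)` is triggered, i.e. the process enters view `v` -/
  enter : Option ℕ

/-- `max {v | ∃ k, m[k] = v ∧ |{j | m[j] ≥ v}| ≥ c}`, the highest view of the array `m` that is
supported by at least `c` entries. -/
def supportedView {f : ℕ} (c : ℕ) (m : Fin (3 * f + 1) → ℕ) : ℕ :=
  (Finset.univ.filter
    (fun k => c ≤ (Finset.univ.filter (fun j => m k ≤ m j)).card)).sup m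

/-- The code run by process `i` in local state `s` when its clock shows `now`. -/
noncomputable def handle {f : ℕ} (F : ℕ → ℝ) (ρ : ℝ) (i : Fin (3 * f + 1)) (now : ℝ)
    (s : LocalState f) : Act f → Outcome f
  | .start =>
      { post := s
        wish := if s.viewPlus = 0 then some 1 else none
        enter := none }
  | .expire =>
      { post := { s with timer := none }
        wish := some (max (s.view + 1) s.viewPlus)
        enter := none }
  | .retransmit =>
      { post := { s with nextRetransmit := now + ρ }
        wish :=
          if s.timer.isSome then some s.viewPlus
          else if 0 < s.maxViews i then some (max (s.view + 1) s.viewPlus)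
          else none
        enter := none }
  | .recv j v =>
      let m := Function.update s.maxViews j (max (s.maxViews j) v)
      let view' := supportedView (2 * f + 1) m
      let viewPlus' := supportedView (f + 1) m
      let enters := viewPlus' = view' ∧ s.view < view'
      { post :=
          { maxViews := m
            view := view'
            viewPlus := viewPlus'
            timer := if enters then some (now + F view') else s.timer
            nextRetransmit := s.nextRetransmit }
        wish := if s.viewPlus < viewPlus' then some viewPlus' else none
        enter := if enters then some view' else none }

/-! ## Executions under partial synchrony -/

/-- The environment: which processes are correct, `GST`, `δ`, and the hardware clocks. -/
structure Env (f : ℕ) where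
  /-- the correct processes; the other ones, at most `f`, are Byzantine -/
  correct : Finset (Fin (3 * f + 1))
  correct_card : 2 * f + 1 ≤ correct.card
  gst : ℝ
  gst_nonneg : 0 ≤ gst
  δ : ℝ
  δ_pos : 0 < δ
  /-- `clock i t` is the reading of the clock of process `i` at real time `t ≥ 0` -/
  clock : Fin (3 * f + 1) → ℝ → ℝ
  clock_mono : ∀ i ∈ correct, MonotoneOn (clock i) (Set.Ici 0)
  /-- Clocks do not drift from `GST` on. Before `GST` they may run at any speed, stall or jump. -/
  clock_rate : ∀ i ∈ correct, ∀ s t, gst ≤ s → s ≤ t → clock i t - clock i s = t - s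

/-- A sequence of events at correct processes in the order in which they happen: event number `k`
is the handling of `act k` by process `proc k` at real time `time k`. Handling an event takes no
time, and several events may happen at the same time. The actions of Byzantine processes are not
listed; they show only in the messages that correct processes receive from them. -/
structure Trace (f : ℕ) where
  time : ℕ → ℝ
  proc : ℕ → Fin (3 * f + 1)
  act : ℕ → Act f
  /-- `phase i` is the local time from time `0` to the first retransmission slot of process `i` -/
  phase : Fin (3 * f + 1) → ℝ

variable {f : ℕ}

/-- The initial state of process `i`. -/
noncomputable def initState (S : Env f) (T : Trace f) (i : Fin (3 * f + 1)) : LocalState f where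
  maxViews := fun _ => 0
  view := 0
  viewPlus := 0
  timer := none
  nextRetransmit := S.clock i 0 + T.phase i

/-- The states of the processes just before event number `k`. -/
noncomputable def state (F : ℕ → ℝ) (ρ : ℝ) (S : Env f) (T : Trace f) :
    ℕ → Fin (3 * f + 1) → LocalState f
  | 0 => initState S T
  | k + 1 => Function.update (state F ρ S T k) (T.proc k)
      (handle F ρ (T.proc k) (S.clock (T.proc k) (T.time k))
        (state F ρ S T k (T.proc k)) (T.act k)).post

/-- The outcome of event number `k`. -/
noncomputable def outcome (F : ℕ → ℝ) (ρ : ℝ) (S : Env f) (T : Trace f) (k : ℕ) : Outcome f :=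
  handle F ρ (T.proc k) (S.clock (T.proc k) (T.time k)) (state F ρ S T k (T.proc k)) (T.act k)

/-- Process `i` sends `WISH(v)` to all at event number `k`. -/
def Sends (F : ℕ → ℝ) (ρ : ℝ) (S : Env f) (T : Trace f) (k : ℕ) (i : Fin (3 * f + 1)) (v : ℕ) :
    Prop :=
  T.proc k = i ∧ (outcome F ρ S T k).wish = some v

/-- Process `i` enters view `v` at event number `k`. -/
def Enters (F : ℕ → ℝ) (ρ : ℝ) (S : Env f) (T : Trace f) (k : ℕ) (i : Fin (3 * f + 1)) (v : ℕ) :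
    Prop :=
  T.proc k = i ∧ (outcome F ρ S T k).enter = some v

/-- `T` is an execution of FastSync in the environment `S`. -/
structure IsExecution (F : ℕ → ℝ) (ρ : ℝ) (S : Env f) (T : Trace f) : Prop where
  time_nonneg : ∀ k, 0 ≤ T.time k
  time_mono : Monotone T.time
  /-- finitely many events happen in bounded time -/
  time_unbounded : Filter.Tendsto T.time Filter.atTop Filter.atTop
  proc_correct : ∀ k, T.proc k ∈ S.correct
  phase_mem : ∀ i ∈ S.correct, T.phase i ∈ Set.Icc 0 ρ
  /-- every correct process calls `start()` once -/
  start_once : ∀ i ∈ S.correct, ∃! k, T.proc k = i ∧ T.act k = .start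
  /-- a timer expires only if it is enabled and the local clock has reached its deadline ... -/
  expire_enabled : ∀ k, T.act k = .expire →
    ∃ D, (state F ρ S T k (T.proc k)).timer = some D ∧ D ≤ S.clock (T.proc k) (T.time k)
  /-- ... and it does expire at that moment, unless it is stopped or restarted. (All events up to
  time `t`, and no other ones, happen before event number `k`.) -/
  expire_urgent : ∀ k t, 0 ≤ t → (∀ l < k, T.time l ≤ t) → t < T.time k → ∀ i ∈ S.correct,
    ∀ D, (state F ρ S T k i).timer = some D → S.clock i t < D
  /-- the retransmission code runs every `ρ` units of local time -/
  retransmit_enabled : ∀ k, T.act k = .retransmit →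
    (state F ρ S T k (T.proc k)).nextRetransmit ≤ S.clock (T.proc k) (T.time k)
  retransmit_urgent : ∀ k t, 0 ≤ t → (∀ l < k, T.time l ≤ t) → t < T.time k → ∀ i ∈ S.correct,
    S.clock i t < (state F ρ S T k i).nextRetransmit
  /-- authenticated links: what is received from a correct process was sent by it before (whatever
  is received from a Byzantine process is arbitrary; links may even duplicate messages) -/
  recv_sent : ∀ k j v, T.act k = .recv j v → j ∈ S.correct → ∃ l < k, Sends F ρ S T l j v
  /-- a message sent at or after `GST` between correct processes is received within `δ`; a message
  sent before `GST` may get lost or arbitrarily delayed -/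
  delivery : ∀ k j v, Sends F ρ S T k j v → S.gst ≤ T.time k → ∀ i ∈ S.correct,
    ∃ l > k, T.proc l = i ∧ T.act l = .recv j v ∧ T.time l ≤ T.time k + S.δ
  /-- a message sent to oneself is received immediately -/
  self_delivery : ∀ k j v, Sends F ρ S T k j v →
    ∃ l > k, T.proc l = j ∧ T.act l = .recv j v ∧ T.time l = T.time k

/-! ## Quantities of an execution -/

/-- The time at which the first correct process enters `v`. -/
noncomputable def tFirst (F : ℕ → ℝ) (ρ : ℝ) (S : Env f) (T : Trace f) (v : ℕ) : ℝ :=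
  sInf {t | ∃ i ∈ S.correct, ∃ k, Enters F ρ S T k i v ∧ T.time k = t}

/-- The time at which the last correct process enters `v`. -/
noncomputable def tLast (F : ℕ → ℝ) (ρ : ℝ) (S : Env f) (T : Trace f) (v : ℕ) : ℝ :=
  sSup {t | ∃ i ∈ S.correct, ∃ k, Enters F ρ S T k i v ∧ T.time k = t}

/-- The local view `LV_i(t)`: the latest, i.e. highest, view entered by `i` at or before time `t`,
or `0` if there is none. -/
noncomputable def localView (F : ℕ → ℝ) (ρ : ℝ) (S : Env f) (T : Trace f)
    (i : Fin (3 * f + 1)) (t : ℝ) : ℕ :=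
  sSup {v | ∃ k, Enters F ρ S T k i v ∧ T.time k ≤ t}

/-- The global view `GV(t)`: the maximum of `LV_i(t)` over the correct processes `i`. -/
noncomputable def globalView (F : ℕ → ℝ) (ρ : ℝ) (S : Env f) (T : Trace f) (t : ℝ) : ℕ :=
  S.correct.sup (fun i => localView F ρ S T i t)

/-- The times at which correct processes call `start()`. -/
def startTimes (S : Env f) (T : Trace f) : Set ℝ :=
  {t | ∃ i ∈ S.correct, ∃ k, T.proc k = i ∧ T.act k = .start ∧ T.time k = t}

/-- The earliest time at which a correct process calls `start()`. -/
noncomputable def sFirst (S : Env f) (T : Trace f) : ℝ := sInf (startTimes S T)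

/-- The latest time at which a correct process calls `start()`. -/
noncomputable def sLast (S : Env f) (T : Trace f) : ℝ := sSup (startTimes S T)

open Classical in
/-- The earliest time by which `m` correct processes have called `start()`. -/
noncomputable def sKth (S : Env f) (T : Trace f) (m : ℕ) : ℝ :=
  sInf {t | m ≤ (S.correct.filter
    (fun i => ∃ k, T.proc k = i ∧ T.act k = .start ∧ T.time k ≤ t)).card}

/-! ## The synchronizer specification -/

/-- Process `i` handles no two events at the same time, not counting the reception of its own
messages (these are received at the time at which they are sent). -/
def NoSimultaneous (T : Trace f) (i : Fin (3 * f + 1)) : Prop :=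
  ∀ k l, T.proc k = i → T.proc l = i → (∀ v, T.act k ≠ .recv i v) → (∀ v, T.act l ≠ .recv i v) →
    T.time k = T.time l → k = l

/-- The synchronizer specification with parameters `d` and `V`. -/
structure SyncSpec (F : ℕ → ℝ) (ρ : ℝ) (S : Env f) (T : Trace f) (d : ℝ) (V : ℕ) : Prop where
  V_pos : 1 ≤ V
  /-- A correct process enters views in increasing order, each one at most once: smaller views are
  entered in earlier events, ... -/
  local_order : ∀ i ∈ S.correct, ∀ k k' v v', Enters F ρ S T k i v → Enters F ρ S T k' i v' →
    (v < v' ↔ k < k')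
  /-- ... and strictly earlier in time unless events at that process are simultaneous. -/
  local_order_time : ∀ i ∈ S.correct, NoSimultaneous T i → ∀ k k' v v',
    Enters F ρ S T k i v → Enters F ρ S T k' i v' → (v < v' ↔ T.time k < T.time k')
  /-- No correct process enters `V` before `GST`. -/
  after_gst : S.gst ≤ tFirst F ρ S T V
  /-- Every correct process enters every view from `V` on. -/
  all_enter : ∀ v ≥ V, ∀ i ∈ S.correct, ∃ k, Enters F ρ S T k i v
  /-- All correct processes enter such a view within `d` of each other. -/
  entry_spread : ∀ v ≥ V, tLast F ρ S T v ≤ tFirst F ρ S T v + d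
  /-- No correct process enters the next view until `F v` after the first entry into `v`. -/
  duration : ∀ v ≥ V, tFirst F ρ S T v + F v ≤ tFirst F ρ S T (v + 1)

end FastSync

/-! Counting drives the proof: of 2f+1 processes supporting a `view` at least f+1 are correct, and
of f+1 supporting a `view⁺` at least one is (`card_wished_of_le_view`,
`exists_wished_of_le_viewPlus`).

Safety: tracing wishes back in time, the earliest correct wish above v > 0 comes from a process that
entered v and whose timer for v ran out (`exists_enters_of_sends`). So if v is first entered after
GST, no correct process wishes beyond v until F(v) later.

Liveness: an entry into v reveals f+1 correct wishes. Within δ they lift every `view⁺` to v, which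
makes every correct process wish for v, and within another δ every `view` reaches v
(`le_view_of_enters`). If F(v) > 2δ, no `view⁺` has passed v by then, so all processes really enter
v (`enters_of_enters`). When the timers run out, all wish for v+1 (`wished_succ_of_le_view`).

Loss before GST is absorbed by `Reliable`. The view a process retransmits never decreases, so one
retransmission in (GST, GST+ρ] makes up for all its wishes before GST: τ = GST+ρ always works, and τ
= GST works if nobody starts earlier. `syncSpec` combines these facts for any V with F(V) > 2δ
entered only from τ on; the three parts of the theorem are choices of τ and V. -/

namespace FastSync

variable {f : ℕ} {F : ℕ → ℝ} {ρ : ℝ} {S : Env f} {T : Trace f} {τ : ℝ}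

/-! ### Supported views as order statistics -/

/-- For c between 1 and the number of entries, `supportedView c m` is the c-th largest entry.
Positivity of u excludes the value 0 that the supremum takes on an empty set. -/
theorem le_supportedView_iff {c u : ℕ} {m : Fin (3 * f + 1) → ℕ} (hc : 0 < c) (hu : 0 < u) :
    u ≤ supportedView c m ↔ c ≤ (Finset.univ.filter (fun j => u ≤ m j)).card := by
  unfold supportedView
  constructor
  · intro h
    obtain ⟨k, hk, huk⟩ := (Finset.le_sup_iff (by simpa using hu)).1 h
    refine (Finset.mem_filter.1 hk).2.trans (Finset.card_le_card fun j hj => ?_)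
    simp only [Finset.mem_filter, Finset.mem_univ, true_and] at hj ⊢
    exact huk.trans hj
  · intro h
    -- The smallest entry that is at least u is itself a supported entry: all entries counted for u
    -- lie above it.
    obtain ⟨k, hk, hmin⟩ := Finset.exists_min_image (Finset.univ.filter (fun j => u ≤ m j)) m
      (Finset.card_pos.1 (hc.trans_le h))
    refine (Finset.mem_filter.1 hk).2.trans (Finset.le_sup (f := m) ?_)
    simp only [Finset.mem_filter, Finset.mem_univ, true_and]
    exact h.trans (Finset.card_le_card fun j hj => by simpa using hmin j hj)

theorem supportedView_mono {c : ℕ} (hc : 0 < c) {m m' : Fin (3 * f + 1) → ℕ} (h : m ≤ m') :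
    supportedView c m ≤ supportedView c m' := by
  rcases Nat.eq_zero_or_pos (supportedView c m) with h0 | h0
  · omega
  · rw [le_supportedView_iff hc h0]
    refine ((le_supportedView_iff hc h0).1 le_rfl).trans (Finset.card_le_card fun j hj => ?_)
    simp only [Finset.mem_filter, Finset.mem_univ, true_and] at hj ⊢
    exact hj.trans (h j)

theorem supportedView_anti {c c' : ℕ} (hc : 0 < c) (h : c ≤ c') (m : Fin (3 * f + 1) → ℕ) :
    supportedView c' m ≤ supportedView c m := by
  rcases Nat.eq_zero_or_pos (supportedView c' m) with h0 | h0
  · omega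
  · rw [le_supportedView_iff hc h0]
    exact h.trans ((le_supportedView_iff (hc.trans_le h) h0).1 le_rfl)

theorem supportedView_zero (c : ℕ) : supportedView c (fun _ : Fin (3 * f + 1) => 0) = 0 := by
  simp [supportedView]

/-- Raising one entry to `w` cannot lift the supported view beyond `w`. -/
theorem supportedView_update_le {c w : ℕ} (hc : 0 < c) (m : Fin (3 * f + 1) → ℕ)
    (j : Fin (3 * f + 1)) :
    supportedView c (Function.update m j (max (m j) w)) ≤ max (supportedView c m) w := by
  by_contra! h
  set m' := Function.update m j (max (m j) w) with hm
  obtain ⟨h1, h2⟩ := max_lt_iff.1 h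
  have h0 : 0 < supportedView c m' := by omega
  have := (le_supportedView_iff hc h0).1 le_rfl
  refine h1.not_ge ((le_supportedView_iff hc h0).2 (this.trans (Finset.card_le_card fun k hk => ?_)))
  simp only [Finset.mem_filter, Finset.mem_univ, true_and] at hk ⊢
  by_cases hkj : k = j
  · subst hkj
    simp only [hm, Function.update_self] at hk h2 ⊢
    omega
  · rwa [show m' k = m k by simp [hm, hkj]] at hk

/-! ### Monotonicity of the local state -/

theorem state_succ_self (k : ℕ) :
    state F ρ S T (k + 1) (T.proc k) = (outcome F ρ S T k).post := by
  simp [state, outcome]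

theorem state_succ_of_ne {k : ℕ} {i : Fin (3 * f + 1)} (h : T.proc k ≠ i) :
    state F ρ S T (k + 1) i = state F ρ S T k i := by
  simp [state, Function.update_of_ne h.symm]

/-- The array `max_views` never decreases. -/
theorem maxViews_monotone (i : Fin (3 * f + 1)) :
    Monotone fun k => (state F ρ S T k i).maxViews := by
  refine monotone_nat_of_le_succ fun k => ?_
  by_cases h : T.proc k = i
  · subst h
    simp only [state_succ_self, outcome]
    cases hA : T.act k with
    | recv j v =>
      intro j'
      by_cases hj : j' = j
      · subst hj; simp [handle]
      · simp [handle, hj]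
    | _ => simp [handle]
  · simp only [state_succ_of_ne h]; exact le_rfl

theorem view_eq_and_viewPlus_eq (k : ℕ) (i : Fin (3 * f + 1)) :
    (state F ρ S T k i).view = supportedView (2 * f + 1) (state F ρ S T k i).maxViews ∧
    (state F ρ S T k i).viewPlus = supportedView (f + 1) (state F ρ S T k i).maxViews := by
  induction k with
  | zero => simp [state, initState, supportedView_zero]
  | succ k ih =>
    by_cases h : T.proc k = i
    · subst h
      rw [state_succ_self, outcome]
      cases hA : T.act k with
      | recv j v => simp [handle]
      | _ => simpa [handle] using ih
    · rwa [state_succ_of_ne h]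

theorem view_monotone (i : Fin (3 * f + 1)) : Monotone fun k => (state F ρ S T k i).view := by
  intro k k' h
  simp only [(view_eq_and_viewPlus_eq _ i).1]
  exact supportedView_mono (by omega) (maxViews_monotone i h)

theorem viewPlus_monotone (i : Fin (3 * f + 1)) :
    Monotone fun k => (state F ρ S T k i).viewPlus := by
  intro k k' h
  simp only [(view_eq_and_viewPlus_eq _ i).2]
  exact supportedView_mono (by omega) (maxViews_monotone i h)

theorem view_le_viewPlus (k : ℕ) (i : Fin (3 * f + 1)) :
    (state F ρ S T k i).view ≤ (state F ρ S T k i).viewPlus := by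
  rw [(view_eq_and_viewPlus_eq k i).1, (view_eq_and_viewPlus_eq k i).2]
  exact supportedView_anti (by omega) (by omega) _

theorem le_maxViews_of_recv {k k' : ℕ} {i j : Fin (3 * f + 1)} {v : ℕ} (hp : T.proc k = i)
    (ha : T.act k = .recv j v) (h : k < k') : v ≤ (state F ρ S T k' i).maxViews j := by
  refine le_trans ?_ (maxViews_monotone i (Nat.succ_le_of_lt h) j)
  subst hp
  simp [state_succ_self, outcome, ha, handle]

/-! ### Quorums and the wishes behind them -/

/-- Process `i` has sent a `WISH` for a view at least `v` before event number `k`. -/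
def Wished (F : ℕ → ℝ) (ρ : ℝ) (S : Env f) (T : Trace f) (k : ℕ) (i : Fin (3 * f + 1)) (v : ℕ) :
    Prop :=
  ∃ l < k, ∃ w ≥ v, Sends F ρ S T l i w

theorem Wished.mono {k k' : ℕ} {i : Fin (3 * f + 1)} {v v' : ℕ} (h : Wished F ρ S T k i v)
    (hk : k ≤ k') (hv : v' ≤ v) : Wished F ρ S T k' i v' := by
  obtain ⟨l, hl, w, hw, hs⟩ := h
  exact ⟨l, by omega, w, by omega, hs⟩

theorem IsExecution.mem_of_sends (hT : IsExecution F ρ S T) {k : ℕ} {i : Fin (3 * f + 1)} {v : ℕ}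
    (h : Sends F ρ S T k i v) : i ∈ S.correct := h.1 ▸ hT.proc_correct k

theorem IsExecution.mem_of_enters (hT : IsExecution F ρ S T) {k : ℕ} {i : Fin (3 * f + 1)} {v : ℕ}
    (h : Enters F ρ S T k i v) : i ∈ S.correct := h.1 ▸ hT.proc_correct k

/-- The index `k - 1` matters: the last event that can shape the state at `k` is the reception
number `k - 1`, and its message was sent strictly before that. This strictness makes the later
strong inductions on events descend. -/
theorem IsExecution.maxViews_sent (hT : IsExecution F ρ S T) (k : ℕ) (i : Fin (3 * f + 1))
    {j : Fin (3 * f + 1)} (hj : j ∈ S.correct) :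
    (state F ρ S T k i).maxViews j = 0 ∨
      Wished F ρ S T (k - 1) j ((state F ρ S T k i).maxViews j) := by
  induction k with
  | zero => simp [state, initState]
  | succ k ih =>
    have ih' : (state F ρ S T k i).maxViews j = 0 ∨
        Wished F ρ S T k j ((state F ρ S T k i).maxViews j) :=
      ih.imp_right fun h => h.mono (by omega) le_rfl
    by_cases h : T.proc k = i
    · subst h
      rw [state_succ_self, outcome]
      cases hA : T.act k with
      | recv j' v =>
        by_cases hjj : j = j'
        · subst hjj
          obtain ⟨l, hl, hs⟩ := hT.recv_sent k j v hA hj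
          rcases le_total v ((state F ρ S T k (T.proc k)).maxViews j) with h | h
          · simpa [handle, h] using ih'
          · right
            simpa [handle, h] using ⟨l, hl, v, le_rfl, hs⟩
        · simpa [handle, hjj] using ih'
      | _ => simpa [handle] using ih'
    · rwa [state_succ_of_ne h]

theorem card_filter_correct (A : Finset (Fin (3 * f + 1))) :
    A.card ≤ (S.correct.filter (· ∈ A)).card + f := by
  classical
  have h1 : A ⊆ S.correct.filter (· ∈ A) ∪ S.correctᶜ := fun a ha => by
    by_cases h : a ∈ S.correct <;> simp [h, ha]
  have h2 := (Finset.card_le_card h1).trans (Finset.card_union_le _ _)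
  have h3 := S.correct_card
  rw [Finset.card_compl, Fintype.card_fin] at h2
  omega

open Classical in
theorem IsExecution.card_wished_of_le_view (hT : IsExecution F ρ S T) {k v : ℕ}
    {i : Fin (3 * f + 1)} (hv : 0 < v) (h : v ≤ (state F ρ S T k i).view) :
    f + 1 ≤ (S.correct.filter (fun j => Wished F ρ S T (k - 1) j v)).card := by
  rw [(view_eq_and_viewPlus_eq k i).1, le_supportedView_iff (by omega) hv] at h
  have h1 := card_filter_correct (S := S)
    (Finset.univ.filter (fun j => v ≤ (state F ρ S T k i).maxViews j))
  refine le_trans (by omega) (Finset.card_le_card (s := S.correct.filter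
    (· ∈ Finset.univ.filter (fun j => v ≤ (state F ρ S T k i).maxViews j))) fun j hj => ?_)
  simp only [Finset.mem_filter, Finset.mem_univ, true_and] at hj ⊢
  refine ⟨hj.1, ?_⟩
  rcases hT.maxViews_sent k i hj.1 with h0 | h0
  · omega
  · exact h0.mono le_rfl hj.2

theorem IsExecution.exists_wished_of_le_viewPlus (hT : IsExecution F ρ S T) {k v : ℕ}
    {i : Fin (3 * f + 1)} (hv : 0 < v) (h : v ≤ (state F ρ S T k i).viewPlus) :
    ∃ j, Wished F ρ S T (k - 1) j v := by
  classical
  rw [(view_eq_and_viewPlus_eq k i).2, le_supportedView_iff (by omega) hv] at h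
  have h1 := card_filter_correct (S := S)
    (Finset.univ.filter (fun j => v ≤ (state F ρ S T k i).maxViews j))
  obtain ⟨j, hj⟩ := Finset.card_pos.1 (show 0 < (S.correct.filter
    (· ∈ Finset.univ.filter (fun j => v ≤ (state F ρ S T k i).maxViews j))).card by omega)
  simp only [Finset.mem_filter, Finset.mem_univ, true_and] at hj
  rcases hT.maxViews_sent k i hj.1 with h0 | h0
  · omega
  · exact ⟨j, h0.mono le_rfl hj.2⟩

/-! ### Entering views and running timers -/

theorem Enters.spec {k v : ℕ} {i : Fin (3 * f + 1)} (h : Enters F ρ S T k i v) :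
    (∃ j w, T.act k = .recv j w) ∧ (state F ρ S T k i).view < v ∧
    (state F ρ S T (k + 1) i).view = v ∧ (state F ρ S T (k + 1) i).viewPlus = v ∧
    (state F ρ S T (k + 1) i).timer = some (S.clock i (T.time k) + F v) := by
  obtain ⟨rfl, h⟩ := h
  rw [state_succ_self]
  simp only [outcome] at h ⊢
  cases hA : T.act k with
  | recv j w =>
    rw [hA] at h
    simp only [handle] at h ⊢
    split_ifs at h with hc
    simp only [Option.some.injEq] at h
    refine ⟨⟨j, w, rfl⟩, ?_⟩
    rw [if_pos hc]
    rw [hc.1, h]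
    rw [h] at hc
    exact ⟨hc.2, rfl, rfl, rfl⟩
  | _ => simp [hA, handle] at h

theorem Enters.lt_of_le_view {k v K : ℕ} {i : Fin (3 * f + 1)} (h : Enters F ρ S T k i v)
    (hK : v ≤ (state F ρ S T K i).view) : k < K := by
  by_contra! hc
  have := view_monotone (F := F) (ρ := ρ) (S := S) (T := T) i hc
  have := h.spec.2.1
  simp only at *
  omega

theorem Enters.le_view {k v K : ℕ} {i : Fin (3 * f + 1)} (h : Enters F ρ S T k i v)
    (hK : k < K) : v ≤ (state F ρ S T K i).view :=
  h.spec.2.2.1.ge.trans (view_monotone i (Nat.succ_le_of_lt hK))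

theorem Enters.lt_iff {k k' v v' : ℕ} {i : Fin (3 * f + 1)} (h : Enters F ρ S T k i v)
    (h' : Enters F ρ S T k' i v') : v < v' ↔ k < k' := by
  constructor
  · intro hv
    have := h.lt_of_le_view (K := k' + 1) (by rw [h'.spec.2.2.1]; omega)
    rcases Nat.lt_or_ge k k' with h1 | h1
    · exact h1
    · obtain rfl : k = k' := by omega
      have := h.2.symm.trans h'.2
      simp only [Option.some.injEq] at this
      omega
  · intro hk
    have h1 := view_monotone (F := F) (ρ := ρ) (S := S) (T := T) i (Nat.succ_le_of_lt hk)
    have := h.spec.2.2.1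
    have := h'.spec.2.1
    simp only [Nat.succ_eq_add_one] at *
    omega

/-- The effect of a reception, in terms of the states before and after it. -/
theorem recv_spec {k w : ℕ} {i j : Fin (3 * f + 1)} (hp : T.proc k = i)
    (ha : T.act k = .recv j w) :
    ((state F ρ S T (k + 1) i).viewPlus = (state F ρ S T (k + 1) i).view →
      (state F ρ S T k i).view < (state F ρ S T (k + 1) i).view →
      Enters F ρ S T k i (state F ρ S T (k + 1) i).view) ∧
    (¬ ((state F ρ S T (k + 1) i).viewPlus = (state F ρ S T (k + 1) i).view ∧
      (state F ρ S T k i).view < (state F ρ S T (k + 1) i).view) →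
      (state F ρ S T (k + 1) i).timer = (state F ρ S T k i).timer) ∧
    (state F ρ S T (k + 1) i).maxViews = Function.update (state F ρ S T k i).maxViews j
      (max ((state F ρ S T k i).maxViews j) w) ∧
    (∀ v, Sends F ρ S T k i v ↔ v = (state F ρ S T (k + 1) i).viewPlus ∧
      (state F ρ S T k i).viewPlus < (state F ρ S T (k + 1) i).viewPlus) := by
  subst hp
  simp only [state_succ_self, Sends, Enters, outcome, ha, handle, true_and]
  refine ⟨fun h1 h2 => by simp [h1, h2], fun h => by rw [if_neg h], ?_⟩
  intro v
  split_ifs with h <;> simp [h, eq_comm]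

theorem eq_of_maxViews_eq {k k' : ℕ} {i : Fin (3 * f + 1)}
    (h : (state F ρ S T k i).maxViews = (state F ρ S T k' i).maxViews) :
    (state F ρ S T k i).view = (state F ρ S T k' i).view ∧
      (state F ρ S T k i).viewPlus = (state F ρ S T k' i).viewPlus := by
  simp only [view_eq_and_viewPlus_eq, h, and_self]

/-- Only receptions change the array `max_views`. -/
theorem maxViews_succ_of_not_recv {k : ℕ} (h : ∀ j w, T.act k ≠ .recv j w) (i : Fin (3 * f + 1)) :
    (state F ρ S T (k + 1) i).maxViews = (state F ρ S T k i).maxViews := by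
  by_cases hp : T.proc k = i
  · subst hp
    rw [state_succ_self, outcome]
    cases hA : T.act k with
    | recv j v => exact absurd hA (h j v)
    | _ => simp [handle]
  · rw [state_succ_of_ne hp]

/-- Once a process has entered the view it is in, its timer is running for that view, or has
expired since. -/
theorem IsExecution.timer_spec (hT : IsExecution F ρ S T) (k : ℕ) (i : Fin (3 * f + 1))
    (h0 : 0 < (state F ρ S T k i).view)
    (h1 : (state F ρ S T k i).viewPlus = (state F ρ S T k i).view) :
    ∃ l < k, Enters F ρ S T l i (state F ρ S T k i).view ∧
      ((state F ρ S T k i).timer = some (S.clock i (T.time l) + F (state F ρ S T k i).view) ∨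
        (state F ρ S T k i).timer = none ∧ ∃ e < k,
          S.clock i (T.time l) + F (state F ρ S T k i).view ≤ S.clock i (T.time e) ∧
          Sends F ρ S T e i ((state F ρ S T k i).view + 1)) := by
  induction k with
  | zero => simp [state, initState] at h0
  | succ k ih =>
    by_cases hp : T.proc k = i
    · cases hA : T.act k with
      | recv j w =>
        obtain ⟨hE, hN, -, -⟩ := recv_spec (F := F) (ρ := ρ) (S := S) hp hA
        by_cases hv : (state F ρ S T k i).view < (state F ρ S T (k + 1) i).view
        · have := hE h1 hv
          exact ⟨k, by omega, this, .inl this.spec.2.2.2.2⟩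
        -- Here `view ≤ view⁺` before the event, `view⁺` cannot drop, and it equals the unchanged
        -- `view` afterwards. So the equality held before, and the timer was left alone.
        · have e1 : (state F ρ S T (k + 1) i).view = (state F ρ S T k i).view :=
            le_antisymm (by omega) (view_monotone i (Nat.le_succ k))
          have e2 := viewPlus_monotone (F := F) (ρ := ρ) (S := S) (T := T) i (Nat.le_succ k)
          have e3 := view_le_viewPlus (F := F) (ρ := ρ) (S := S) (T := T) k i
          simp only [Nat.succ_eq_add_one] at e2
          rw [hN (fun h => hv h.2), e1]
          obtain ⟨l, hl, hl1, hl2⟩ := ih (by omega) (by omega)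
          refine ⟨l, by omega, hl1, hl2.imp_right fun ⟨h, e, he, h'⟩ => ⟨h, e, by omega, h'⟩⟩
      | expire =>
        have hs : (state F ρ S T (k + 1) i).view = (state F ρ S T k i).view ∧
            (state F ρ S T (k + 1) i).viewPlus = (state F ρ S T k i).viewPlus ∧
            (state F ρ S T (k + 1) i).timer = none := by
          subst hp
          rw [state_succ_self, outcome, hA]
          simp [handle]
        rw [hs.1] at h0 h1 ⊢
        rw [hs.2.1] at h1
        rw [hs.2.2]
        obtain ⟨l, hl, hl1, hl2⟩ := ih h0 h1
        refine ⟨l, by omega, hl1, .inr ⟨rfl, ?_⟩⟩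
        rcases hl2 with h | ⟨-, e, he, h⟩
        · obtain ⟨D, hD, hD'⟩ := hT.expire_enabled k hA
          rw [hp, h, Option.some.injEq] at hD
          refine ⟨k, by omega, by rw [hD, ← hp]; exact hD', hp, ?_⟩
          subst hp
          simp [outcome, hA, handle, h1]
        · exact ⟨e, by omega, h⟩
      | _ =>
        have hs : (state F ρ S T (k + 1) i).view = (state F ρ S T k i).view ∧
            (state F ρ S T (k + 1) i).viewPlus = (state F ρ S T k i).viewPlus ∧
            (state F ρ S T (k + 1) i).timer = (state F ρ S T k i).timer := by
          subst hp
          rw [state_succ_self, outcome, hA]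
          simp [handle]
        rw [hs.1] at h0 h1 ⊢
        rw [hs.2.1] at h1
        rw [hs.2.2]
        obtain ⟨l, hl, hl1, hl2⟩ := ih h0 h1
        exact ⟨l, by omega, hl1, hl2.imp_right fun ⟨h, e, he, h'⟩ => ⟨h, e, by omega, h'⟩⟩
    · rw [state_succ_of_ne hp] at h0 h1 ⊢
      obtain ⟨l, hl, hl1, hl2⟩ := ih h0 h1
      exact ⟨l, by omega, hl1, hl2.imp_right fun ⟨h, e, he, h'⟩ => ⟨h, e, by omega, h'⟩⟩

theorem view_pos_of_timer {k : ℕ} {i : Fin (3 * f + 1)}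
    (h : (state F ρ S T k i).timer ≠ none) : 0 < (state F ρ S T k i).view := by
  induction k with
  | zero => simp [state, initState] at h
  | succ k ih =>
    have hm := view_monotone (F := F) (ρ := ρ) (S := S) (T := T) i (Nat.le_succ k)
    simp only [Nat.succ_eq_add_one] at hm
    by_cases h' : (state F ρ S T k i).timer = none
    · by_cases hp : T.proc k = i
      · cases hA : T.act k with
        | recv j w =>
          by_contra hc
          exact h ((recv_spec (F := F) (ρ := ρ) (S := S) hp hA).2.1 (by omega) |>.trans h')
        | _ =>
          subst hp
          rw [state_succ_self, outcome, hA] at h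
          simp [handle, h'] at h
      · rw [state_succ_of_ne hp] at h
        exact absurd h' h
    · exact (ih h').trans_le hm

theorem viewPlus_le_succ (k : ℕ) (i : Fin (3 * f + 1)) :
    (state F ρ S T k i).viewPlus ≤ (state F ρ S T (k + 1) i).viewPlus :=
  viewPlus_monotone i (Nat.le_succ k)

/-! ### What must precede a wish -/

/-- A process wishes for a view above `view⁺` only if it is the next one after its view. -/
theorem Sends.spec {k v : ℕ} {i : Fin (3 * f + 1)} (h : Sends F ρ S T k i v) :
    v ≤ (state F ρ S T (k + 1) i).viewPlus ∨
      v = (state F ρ S T k i).view + 1 ∧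
      (state F ρ S T k i).viewPlus = (state F ρ S T k i).view ∧
      (∀ j w, T.act k ≠ .recv j w) ∧
      (T.act k = .start ∨ T.act k = .expire ∨ 0 < (state F ρ S T k i).maxViews i) := by
  have hm := viewPlus_le_succ (F := F) (ρ := ρ) (S := S) (T := T) k i
  have hv := view_le_viewPlus (F := F) (ρ := ρ) (S := S) (T := T) k i
  cases hA : T.act k with
  | recv j w => exact .inl (((recv_spec h.1 hA).2.2.2 v).1 h).1.le
  | start =>
    obtain ⟨rfl, h⟩ := h
    simp only [outcome, hA, handle] at h
    split_ifs at h with h0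
    simp only [Option.some.injEq] at h
    right
    simp
    omega
  | expire =>
    obtain ⟨rfl, h⟩ := h
    simp only [outcome, hA, handle, Option.some.injEq] at h
    simp
    omega
  | retransmit =>
    obtain ⟨rfl, h⟩ := h
    simp only [outcome, hA, handle] at h
    split_ifs at h with h0 h1 <;> simp only [Option.some.injEq] at h <;> simp <;> omega

/-- A wish for `v + 1` is sent only after some correct process entered `v` and its timer for `v`
ran out. -/
theorem IsExecution.exists_enters_of_sends (hT : IsExecution F ρ S T) {v : ℕ} (hv : 0 < v) (k : ℕ) :
    ∀ i w, v < w → Sends F ρ S T k i w → ∃ j, ∃ l ≤ k, ∃ e ≤ k, l ≤ e ∧ Enters F ρ S T l j v ∧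
      S.clock j (T.time l) + F v ≤ S.clock j (T.time e) := by
  induction k using Nat.strong_induction_on with
  | _ k ih =>
    intro i w hw hs
    by_cases h : v + 1 ≤ (state F ρ S T (k + 1) i).viewPlus
    · obtain ⟨j, l, hl, w', hw', hs'⟩ := hT.exists_wished_of_le_viewPlus (by omega) h
      obtain ⟨j, l', hl', e, he, h'⟩ := ih l (by omega) j w' (by omega) hs'
      exact ⟨j, l', by omega, e, by omega, h'⟩
    · rcases hs.spec with h1 | ⟨h1, h2, h3, h4⟩
      · omega
      have hm := viewPlus_le_succ (F := F) (ρ := ρ) (S := S) (T := T) k i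
      have hvv : (state F ρ S T k i).view = v := by omega
      obtain ⟨l, hl, hl1, hl2⟩ := hT.timer_spec k i (by omega) h2
      rw [hvv] at hl1 hl2
      have hp := hs.1
      have key : ∃ e ≤ k, l ≤ e ∧ S.clock i (T.time l) + F v ≤ S.clock i (T.time e) := by
        rcases hl2 with h5 | ⟨-, e, he, h5, -⟩
        · have h6 : T.act k = .expire := by
            cases hA : T.act k with
            | expire => rfl
            | recv j w => exact absurd hA (h3 j w)
            | start =>
              have := hs.2
              subst hp
              simp [outcome, hA, handle] at this
              omega
            | retransmit =>
              have := hs.2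
              subst hp
              simp [outcome, hA, handle, h5] at this
              omega
          obtain ⟨D, hD, hD'⟩ := hT.expire_enabled k h6
          rw [hp, h5, Option.some.injEq] at hD
          rw [hp] at hD'
          exact ⟨k, le_rfl, hl.le, hD ▸ hD'⟩
        -- `timer_spec` does not order the expiry `e` after the entry `l`. If `e` came first,
        -- monotonicity of the clock would give the inequality at `l` itself.
        · rcases le_total l e with hle | hle
          · exact ⟨e, he.le, hle, h5⟩
          · exact ⟨l, hl.le, le_rfl, h5.trans (S.clock_mono i (hT.mem_of_sends hs)
              (hT.time_nonneg e) (hT.time_nonneg l) (hT.time_mono hle))⟩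
      obtain ⟨e, he, hle, h5⟩ := key
      exact ⟨i, l, hl.le, e, he, hle, hl1, h5⟩

theorem IsExecution.add_le_time_of_sends (hT : IsExecution F ρ S T) {v : ℕ} (hv : 0 < v) {t : ℝ}
    (ht : S.gst ≤ t) (hE : ∀ k i, Enters F ρ S T k i v → t ≤ T.time k) {k w : ℕ}
    {i : Fin (3 * f + 1)} (hw : v < w) (hs : Sends F ρ S T k i w) : t + F v ≤ T.time k := by
  obtain ⟨j, l, hl, e, he, hle, h1, h2⟩ := hT.exists_enters_of_sends hv k i w hw hs
  have h3 := hE l j h1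
  have h4 := S.clock_rate j (hT.mem_of_enters h1) (T.time l) (T.time e) (ht.trans h3)
    (hT.time_mono hle)
  have := hT.time_mono he
  linarith

/-- Any other cause of a wish (positive `view⁺`, an enabled timer, a positive own entry) presupposes
an earlier correct wish, so the chain of causes ends in a `start()`. -/
theorem IsExecution.exists_start_of_sends (hT : IsExecution F ρ S T) (k : ℕ) :
    ∀ i w, 0 < w → Sends F ρ S T k i w → ∃ l ≤ k, T.act l = .start := by
  induction k using Nat.strong_induction_on with
  | _ k ih =>
    intro i w hw hs
    have key : ∀ j, Wished F ρ S T k j 1 → ∃ l ≤ k, T.act l = .start := by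
      rintro j ⟨l, hl, w', hw', hs'⟩
      obtain ⟨l', hl', h'⟩ := ih l hl j w' hw' hs'
      exact ⟨l', by omega, h'⟩
    by_cases h : 1 ≤ (state F ρ S T (k + 1) i).viewPlus
    · obtain ⟨j, hj⟩ := hT.exists_wished_of_le_viewPlus (by omega) h
      exact key j hj
    · rcases hs.spec with h1 | ⟨h1, h2, h3, h4 | h4 | h4⟩
      · omega
      · exact ⟨k, le_rfl, h4⟩
      · have hm := viewPlus_le_succ (F := F) (ρ := ρ) (S := S) (T := T) k i
        obtain ⟨D, hD, -⟩ := hT.expire_enabled k h4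
        rw [hs.1] at hD
        have := view_pos_of_timer (F := F) (ρ := ρ) (S := S) (T := T) (k := k) (i := i)
          (by simp [hD])
        omega
      · rcases hT.maxViews_sent k i (hT.mem_of_sends hs) with h5 | h5
        · omega
        · exact key i (h5.mono (by omega) h4)

/-! ### Persistence of wishes -/

theorem Sends.wished {k v : ℕ} {i : Fin (3 * f + 1)} (h : Sends F ρ S T k i v) :
    Wished F ρ S T (k + 1) i v := ⟨k, by omega, v, le_rfl, h⟩

/-- A process has wished for its `view⁺`. -/
theorem wished_viewPlus (k : ℕ) (i : Fin (3 * f + 1))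
    (h : 0 < (state F ρ S T k i).viewPlus) :
    Wished F ρ S T k i (state F ρ S T k i).viewPlus := by
  induction k with
  | zero => simp [state, initState] at h
  | succ k ih =>
    have hm := viewPlus_le_succ (F := F) (ρ := ρ) (S := S) (T := T) k i
    by_cases h1 : (state F ρ S T k i).viewPlus = (state F ρ S T (k + 1) i).viewPlus
    · rw [← h1] at h ⊢
      exact (ih h).mono (by omega) le_rfl
    · by_cases hr : ∃ j w, T.act k = .recv j w
      · obtain ⟨j, w, hA⟩ := hr
        by_cases hp : T.proc k = i
        · exact (((recv_spec hp hA).2.2.2 _).2 ⟨rfl, by omega⟩).wished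
        · rw [state_succ_of_ne hp] at h1
          exact absurd rfl h1
      · push Not at hr
        exact absurd (eq_of_maxViews_eq (maxViews_succ_of_not_recv hr i)).2.symm h1

/-- After `start()`, a process has wished for view `1`. -/
theorem wished_one_of_start {k : ℕ} {i : Fin (3 * f + 1)} (hp : T.proc k = i)
    (hA : T.act k = .start) : Wished F ρ S T (k + 1) i 1 := by
  by_cases h : (state F ρ S T k i).viewPlus = 0
  · refine Sends.wished ⟨hp, ?_⟩
    subst hp
    simp [outcome, hA, handle, h]
  · exact (wished_viewPlus k i (by omega)).mono (by omega) (by omega)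

/-- The view a process wishes for when it retransmits. -/
def nextWish (s : LocalState f) : ℕ :=
  if s.timer.isSome then s.viewPlus else max (s.view + 1) s.viewPlus

/-- The value could drop only when a view is entered and `max (view + 1) view⁺` gives way to
`view⁺`. But then the new `view⁺` equals the new `view`, which exceeds the old one. -/
theorem nextWish_monotone (i : Fin (3 * f + 1)) :
    Monotone fun k => nextWish (state F ρ S T k i) := by
  refine monotone_nat_of_le_succ fun k => ?_
  simp only [nextWish]
  by_cases hp : T.proc k = i
  · cases hA : T.act k with
    | recv j w =>
      obtain ⟨hE, hN, -, -⟩ := recv_spec (F := F) (ρ := ρ) (S := S) hp hA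
      have h1 := viewPlus_le_succ (F := F) (ρ := ρ) (S := S) (T := T) k i
      have h2 := view_monotone (F := F) (ρ := ρ) (S := S) (T := T) i (Nat.le_succ k)
      simp only [Nat.succ_eq_add_one] at h2
      by_cases hc : (state F ρ S T (k + 1) i).viewPlus = (state F ρ S T (k + 1) i).view ∧
          (state F ρ S T k i).view < (state F ρ S T (k + 1) i).view
      · split_ifs <;> omega
      · rw [hN hc]
        split_ifs <;> omega
    | expire =>
      subst hp
      simp only [state_succ_self, outcome, hA, handle]
      split_ifs <;> simp_all
    | _ =>
      subst hp
      simp only [state_succ_self, outcome, hA, handle]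
      exact le_rfl
  · rw [state_succ_of_ne hp]

theorem Sends.le_nextWish {k v : ℕ} {i : Fin (3 * f + 1)} (h : Sends F ρ S T k i v) :
    v ≤ nextWish (state F ρ S T (k + 1) i) := by
  rcases h.spec with h1 | ⟨h1, h2, h3, h4⟩
  · exact h1.trans (by unfold nextWish; split_ifs <;> omega)
  · cases hA : T.act k with
    | recv j w => exact absurd hA (h3 j w)
    | start =>
      have h5 : (state F ρ S T k i).viewPlus = 0 := by
        obtain ⟨rfl, h⟩ := h
        by_contra hc
        simp [outcome, hA, handle, hc] at h
      have h6 : (state F ρ S T k i).timer = none := by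
        by_contra hc
        have := view_pos_of_timer hc
        omega
      obtain ⟨rfl, -⟩ := h
      simp only [nextWish, state_succ_self, outcome, hA, handle, h6]
      simp; omega
    | expire =>
      obtain ⟨rfl, -⟩ := h
      simp only [nextWish, state_succ_self, outcome, hA, handle]
      simp; omega
    | retransmit =>
      obtain ⟨rfl, h⟩ := h
      simp only [outcome, hA, handle] at h
      simp only [nextWish, state_succ_self, outcome, hA, handle]
      split_ifs at h ⊢ <;> simp_all

theorem Sends.le_nextWish_of_lt {k k' v : ℕ} {i : Fin (3 * f + 1)} (h : Sends F ρ S T k i v)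
    (hk : k < k') : v ≤ nextWish (state F ρ S T k' i) :=
  h.le_nextWish.trans (nextWish_monotone i (Nat.succ_le_of_lt hk))

/-! ### Real time, event numbers and retransmission -/

open Classical in
/-- The number of events that happen at or before time `t`. -/
noncomputable def eventsUpTo (T : Trace f) (t : ℝ) : ℕ :=
  if h : ∃ k, t < T.time k then Nat.find h else 0

/-- The bridge between event numbers and real time: the state at `eventsUpTo T t` is the one after
all events up to t. As times are unbounded, the default value 0 never occurs here. -/
theorem IsExecution.lt_eventsUpTo_iff (hT : IsExecution F ρ S T) {t : ℝ} {l : ℕ} :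
    l < eventsUpTo T t ↔ T.time l ≤ t := by
  classical
  have h : ∃ k, t < T.time k := (hT.time_unbounded.eventually_gt_atTop t).exists
  rw [eventsUpTo, dif_pos h]
  constructor
  · intro hl
    exact not_lt.1 (Nat.find_min h hl)
  · intro hl
    by_contra! hc
    exact absurd (hT.time_mono hc) (not_le.2 (hl.trans_lt (Nat.find_spec h)))

theorem IsExecution.lt_time_eventsUpTo (hT : IsExecution F ρ S T) (t : ℝ) :
    t < T.time (eventsUpTo T t) := by
  by_contra! hc
  exact lt_irrefl _ (hT.lt_eventsUpTo_iff.2 hc)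

theorem IsExecution.eventsUpTo_mono (hT : IsExecution F ρ S T) : Monotone (eventsUpTo T) := by
  intro s t h
  by_contra! hc
  exact lt_irrefl _ (hT.lt_eventsUpTo_iff.2 ((hT.lt_eventsUpTo_iff.1 hc).trans h))

theorem nextRetransmit_spec (k : ℕ) (i : Fin (3 * f + 1)) :
    (state F ρ S T k i).nextRetransmit = S.clock i 0 + T.phase i ∨
      ∃ l < k, T.proc l = i ∧ T.act l = .retransmit ∧
        (state F ρ S T k i).nextRetransmit = S.clock i (T.time l) + ρ := by
  induction k with
  | zero => simp [state, initState]
  | succ k ih =>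
    have ih' : (state F ρ S T k i).nextRetransmit = S.clock i 0 + T.phase i ∨
        ∃ l < k + 1, T.proc l = i ∧ T.act l = .retransmit ∧
          (state F ρ S T k i).nextRetransmit = S.clock i (T.time l) + ρ :=
      ih.imp_right fun ⟨l, hl, h⟩ => ⟨l, by omega, h⟩
    by_cases hp : T.proc k = i
    · cases hA : T.act k with
      | retransmit =>
        refine .inr ⟨k, by omega, hp, hA, ?_⟩
        subst hp
        simp [state_succ_self, outcome, hA, handle]
      | _ =>
        have : (state F ρ S T (k + 1) i).nextRetransmit = (state F ρ S T k i).nextRetransmit := by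
          subst hp
          simp [state_succ_self, outcome, hA, handle]
        rwa [this]
    · rwa [state_succ_of_ne hp]

/-- After all events up to GST+ρ, the next slot lies beyond the clock reading at GST plus ρ. The
initial slot is too early for this, so the slot was set by a retransmission after GST. -/
theorem IsExecution.exists_retransmit (hT : IsExecution F ρ S T) (hρ : 0 < ρ)
    {i : Fin (3 * f + 1)} (hi : i ∈ S.correct) :
    ∃ l, T.proc l = i ∧ T.act l = .retransmit ∧ S.gst < T.time l ∧ T.time l ≤ S.gst + ρ := by
  have hg := S.gst_nonneg
  have h1 := hT.retransmit_urgent (eventsUpTo T (S.gst + ρ)) (S.gst + ρ) (by linarith)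
    (fun l hl => hT.lt_eventsUpTo_iff.1 hl) (hT.lt_time_eventsUpTo _) i hi
  have h2 := S.clock_rate i hi S.gst (S.gst + ρ) le_rfl (by linarith)
  rcases nextRetransmit_spec (F := F) (ρ := ρ) (S := S) (T := T) (eventsUpTo T (S.gst + ρ)) i with
    h | ⟨l, hl, hp, hA, h⟩
  · have h3 := S.clock_mono i hi (Set.mem_Ici.2 le_rfl) (Set.mem_Ici.2 hg) hg
    have h4 := (hT.phase_mem i hi).2
    linarith
  · refine ⟨l, hp, hA, ?_, hT.lt_eventsUpTo_iff.1 hl⟩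
    by_contra! hc
    have := S.clock_mono i hi (hT.time_nonneg l) (Set.mem_Ici.2 hg) hc
    linarith

/-! ### Reliable wishes and their amplification -/

/-- From time `τ ≥ GST` on, all that has been wished for so far has also been wished for between
`GST` and now, when messages are delivered timely. -/
structure Reliable (F : ℕ → ℝ) (ρ : ℝ) (S : Env f) (T : Trace f) (τ : ℝ) : Prop where
  gst_le : S.gst ≤ τ
  exists_sends : ∀ k i v, 0 < v → Sends F ρ S T k i v → ∃ l, ∃ w ≥ v, Sends F ρ S T l i w ∧
    S.gst ≤ T.time l ∧ T.time l ≤ max τ (T.time k)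

theorem IsExecution.self_le_maxViews (hT : IsExecution F ρ S T) {k k' v : ℕ}
    {i : Fin (3 * f + 1)} (hs : Sends F ρ S T k i v) (h : T.time k < T.time k') :
    v ≤ (state F ρ S T k' i).maxViews i := by
  obtain ⟨l, -, hp, hA, ht⟩ := hT.self_delivery k i v hs
  refine le_maxViews_of_recv hp hA ?_
  by_contra! hc
  exact absurd (hT.time_mono hc) (by rw [ht]; exact h.not_ge)

theorem IsExecution.reliable_add (hT : IsExecution F ρ S T) (hρ : 0 < ρ) :
    Reliable F ρ S T (S.gst + ρ) where
  gst_le := by linarith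
  exists_sends k i v hv hs := by
    rcases le_or_gt S.gst (T.time k) with h | h
    · exact ⟨k, v, le_rfl, hs, h, le_max_right _ _⟩
    · obtain ⟨l, hp, hA, h1, h2⟩ := hT.exists_retransmit hρ (hT.mem_of_sends hs)
      have hkl : k < l := by
        by_contra! hc
        exact absurd (hT.time_mono hc) (by linarith)
      refine ⟨l, _, hs.le_nextWish_of_lt hkl, ⟨hp, ?_⟩, h1.le, h2.trans (le_max_left _ _)⟩
      -- The process has received its own wish by now, so its own entry is positive and the
      -- retransmission is not silent.
      have h3 := hT.self_le_maxViews hs (h.trans h1)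
      subst hp
      simp only [outcome, hA, handle, nextWish]
      split_ifs <;> first | rfl | omega

theorem IsExecution.reliable_gst (hT : IsExecution F ρ S T)
    (h : ∀ k, T.act k = .start → S.gst ≤ T.time k) : Reliable F ρ S T S.gst where
  gst_le := le_rfl
  exists_sends k i v hv hs := by
    obtain ⟨l, hl, hA⟩ := hT.exists_start_of_sends k i v hv hs
    exact ⟨k, v, le_rfl, hs, (h l hA).trans (hT.time_mono hl), le_max_right _ _⟩

theorem IsExecution.le_maxViews_of_wished (hT : IsExecution F ρ S T) (hτ : Reliable F ρ S T τ)
    {t : ℝ} (ht : τ ≤ t) {i j : Fin (3 * f + 1)} (hj : j ∈ S.correct) {v : ℕ}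
    (h : Wished F ρ S T (eventsUpTo T t) i v) :
    v ≤ (state F ρ S T (eventsUpTo T (t + S.δ)) j).maxViews i := by
  rcases Nat.eq_zero_or_pos v with rfl | hv
  · exact Nat.zero_le _
  obtain ⟨k, hk, w, hw, hs⟩ := h
  obtain ⟨l, w', hw', hs', h1, h2⟩ := hτ.exists_sends k i w (by omega) hs
  obtain ⟨l', -, hp, hA, h3⟩ := hT.delivery l i w' hs' h1 j hj
  have h4 := max_le ht (hT.lt_eventsUpTo_iff.1 hk)
  exact (hw.trans hw').trans (le_maxViews_of_recv hp hA (hT.lt_eventsUpTo_iff.2 (by linarith)))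

open Classical in
theorem IsExecution.le_viewPlus_of_wished (hT : IsExecution F ρ S T) (hτ : Reliable F ρ S T τ)
    {t : ℝ} (ht : τ ≤ t) {v : ℕ} (hv : 0 < v)
    (h : f + 1 ≤ (S.correct.filter (fun i => Wished F ρ S T (eventsUpTo T t) i v)).card)
    {j : Fin (3 * f + 1)} (hj : j ∈ S.correct) :
    v ≤ (state F ρ S T (eventsUpTo T (t + S.δ)) j).viewPlus := by
  rw [(view_eq_and_viewPlus_eq _ j).2, le_supportedView_iff (by omega) hv]
  refine h.trans (Finset.card_le_card fun i hi => ?_)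
  simp only [Finset.mem_filter, Finset.mem_univ, true_and] at hi ⊢
  exact hT.le_maxViews_of_wished hτ ht hj hi.2

theorem IsExecution.le_view_of_wished (hT : IsExecution F ρ S T) (hτ : Reliable F ρ S T τ)
    {t : ℝ} (ht : τ ≤ t) {v : ℕ} (hv : 0 < v)
    (h : ∀ i ∈ S.correct, Wished F ρ S T (eventsUpTo T t) i v)
    {j : Fin (3 * f + 1)} (hj : j ∈ S.correct) :
    v ≤ (state F ρ S T (eventsUpTo T (t + S.δ)) j).view := by
  rw [(view_eq_and_viewPlus_eq _ j).1, le_supportedView_iff (by omega) hv]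
  refine S.correct_card.trans (Finset.card_le_card fun i hi => ?_)
  simp only [Finset.mem_filter, Finset.mem_univ, true_and]
  exact hT.le_maxViews_of_wished hτ ht hj (h i hi)

-- Amplification: f+1 wishes lift every `view⁺` within δ, whereupon all correct processes, at least
-- 2f+1 of them, have wished; one more δ delivers those wishes.
open Classical in
theorem IsExecution.le_view_of_card_wished (hT : IsExecution F ρ S T) (hτ : Reliable F ρ S T τ)
    {t : ℝ} (ht : τ ≤ t) {v : ℕ} (hv : 0 < v)
    (h : f + 1 ≤ (S.correct.filter (fun i => Wished F ρ S T (eventsUpTo T t) i v)).card)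
    {j : Fin (3 * f + 1)} (hj : j ∈ S.correct) :
    v ≤ (state F ρ S T (eventsUpTo T (t + 2 * S.δ)) j).view := by
  have hδ := S.δ_pos
  rw [two_mul, ← add_assoc]
  refine hT.le_view_of_wished hτ (by linarith) hv (fun i hi => ?_) hj
  have := hT.le_viewPlus_of_wished hτ ht hv h hi
  exact (wished_viewPlus _ i (by omega)).mono le_rfl this

theorem IsExecution.le_view_of_enters (hT : IsExecution F ρ S T) (hτ : Reliable F ρ S T τ)
    {k v : ℕ} {p : Fin (3 * f + 1)} (hv : 0 < v) (h : Enters F ρ S T k p v) {t : ℝ} (ht : τ ≤ t)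
    (hk : T.time k ≤ t) {j : Fin (3 * f + 1)} (hj : j ∈ S.correct) :
    v ≤ (state F ρ S T (eventsUpTo T (t + 2 * S.δ)) j).view := by
  classical
  refine hT.le_view_of_card_wished hτ ht hv ?_ hj
  refine (hT.card_wished_of_le_view hv h.spec.2.2.1.ge).trans
    (Finset.card_le_card fun i hi => ?_)
  simp only [Finset.mem_filter] at hi ⊢
  exact ⟨hi.1, hi.2.mono (by have := hT.lt_eventsUpTo_iff.2 hk; omega) le_rfl⟩

/-! ### Progress through the views -/

/-- A process that has reached view `g` wishes for a higher one after at most `F g`. -/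
theorem IsExecution.wished_succ_of_le_view (hT : IsExecution F ρ S T) (hF : ∀ v, 0 ≤ F v) {g : ℕ}
    (hg : 0 < g) {t : ℝ} (ht : S.gst ≤ t) {i : Fin (3 * f + 1)} (hi : i ∈ S.correct)
    (h : g ≤ (state F ρ S T (eventsUpTo T t) i).view) :
    Wished F ρ S T (eventsUpTo T (t + F g)) i (g + 1) := by
  have hFg := hF g
  have hm := hT.eventsUpTo_mono (show t ≤ t + F g by linarith)
  have h1 := h.trans (view_monotone i hm)
  have h2 := view_le_viewPlus (F := F) (ρ := ρ) (S := S) (T := T) (eventsUpTo T (t + F g)) i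
  by_cases h3 : g + 1 ≤ (state F ρ S T (eventsUpTo T (t + F g)) i).viewPlus
  · exact (wished_viewPlus _ i (by omega)).mono le_rfl h3
  have hv : (state F ρ S T (eventsUpTo T (t + F g)) i).view = g := by
    simp only at h1; omega
  obtain ⟨l, hl, hE, h5⟩ := hT.timer_spec (eventsUpTo T (t + F g)) i (by omega) (by omega)
  rw [hv] at hE h5
  rcases h5 with h5 | ⟨-, e, he, -, hs⟩
  -- View g was entered by time t, so its deadline is at most the clock reading at t plus F(g),
  -- which is the reading at t + F(g). A timer still running then contradicts urgency.
  · exfalso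
    have hg0 := S.gst_nonneg
    have h6 := hT.expire_urgent (eventsUpTo T (t + F g)) (t + F g) (by linarith)
      (fun l hl => hT.lt_eventsUpTo_iff.1 hl) (hT.lt_time_eventsUpTo _) i hi _ h5
    have h7 := hT.lt_eventsUpTo_iff.1 (hE.lt_of_le_view h)
    have h8 := S.clock_mono i hi (hT.time_nonneg l) (Set.mem_Ici.2 (hg0.trans ht)) h7
    have h9 := S.clock_rate i hi t (t + F g) ht (by linarith)
    linarith
  · exact ⟨e, he, g + 1, le_rfl, hs⟩

/-- If correct processes have reached view `v`, then one of them has entered it. -/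
theorem IsExecution.exists_enters_of_le_view (hT : IsExecution F ρ S T) {k v : ℕ} (hv : 0 < v)
    {i : Fin (3 * f + 1)} (h : v ≤ (state F ρ S T k i).view) :
    ∃ l < k, ∃ j, Enters F ρ S T l j v := by
  induction k generalizing i with
  | zero => simp [state, initState] at h; omega
  | succ k ih =>
    by_cases hk : ∃ j, v ≤ (state F ρ S T k j).view
    · obtain ⟨j, hj⟩ := hk
      obtain ⟨l, hl, h'⟩ := ih hj
      exact ⟨l, by omega, h'⟩
    push Not at hk
    have hvi := hk i
    by_cases hp : T.proc k = i
    · by_cases hr : ∃ j w, T.act k = .recv j w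
      · obtain ⟨j, w, hA⟩ := hr
        have h1 := view_le_viewPlus (F := F) (ρ := ρ) (S := S) (T := T) (k + 1) i
        -- At the first event at which some process reaches v, `view⁺` cannot be beyond v: that
        -- would require a wish above v, hence an earlier entry into v. So `view⁺ = view = v`, and v
        -- is not skipped.
        have h2 : (state F ρ S T (k + 1) i).viewPlus < v + 1 := by
          by_contra! hc
          obtain ⟨j', l, hl, w', hw', hs⟩ := hT.exists_wished_of_le_viewPlus (by omega) hc
          obtain ⟨p, l', hl', -, -, -, hE, -⟩ :=
            hT.exists_enters_of_sends hv l j' w' (by omega) hs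
          have h3 := view_monotone (F := F) (ρ := ρ) (S := S) (T := T) p
            (show l' + 1 ≤ k by omega)
          have := hk p
          have := hE.spec.2.2.1
          simp only at h3
          omega
        have hE := (recv_spec (F := F) (ρ := ρ) (S := S) hp hA).1 (by omega) (by omega)
        rw [show (state F ρ S T (k + 1) i).view = v by omega] at hE
        exact ⟨k, by omega, i, hE⟩
      · push Not at hr
        have := (eq_of_maxViews_eq (F := F) (ρ := ρ) (S := S) (maxViews_succ_of_not_recv hr i)).1
        omega
    · rw [state_succ_of_ne hp] at h
      omega

/-- Every correct process reaches every view. -/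
theorem IsExecution.exists_forall_le_view (hT : IsExecution F ρ S T) (hF : ∀ v, 0 ≤ F v)
    (hτ : Reliable F ρ S T τ) (v : ℕ) :
    ∃ t, τ ≤ t ∧ ∀ i ∈ S.correct, v + 1 ≤ (state F ρ S T (eventsUpTo T t) i).view := by
  have hδ := S.δ_pos
  induction v with
  | zero =>
    choose! st hst using fun i hi => (hT.start_once i hi).exists
    obtain ⟨k, hk⟩ := (S.correct.image st).exists_le
    have hW : ∀ i ∈ S.correct, Wished F ρ S T (eventsUpTo T (max τ (T.time k))) i 1 := by
      intro i hi
      refine (wished_one_of_start (hst i hi).1 (hst i hi).2).mono ?_ le_rfl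
      exact hT.lt_eventsUpTo_iff.2 ((hT.time_mono (hk _ (Finset.mem_image_of_mem st hi))).trans
        (le_max_right _ _))
    exact ⟨max τ (T.time k) + S.δ, by linarith [le_max_left τ (T.time k)], fun i hi =>
      hT.le_view_of_wished hτ (le_max_left _ _) (by omega) hW hi⟩
  | succ v ih =>
    obtain ⟨t, ht, h⟩ := ih
    have hFv := hF (v + 1)
    exact ⟨t + F (v + 1) + S.δ, by linarith, fun i hi =>
      hT.le_view_of_wished hτ (by linarith) (by omega)
        (fun j hj => hT.wished_succ_of_le_view hF (by omega) (hτ.gst_le.trans ht) hj (h j hj)) hi⟩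

theorem Env.correct_nonempty (S : Env f) : S.correct.Nonempty :=
  Finset.card_pos.1 (by have := S.correct_card; omega)

theorem IsExecution.exists_enters (hT : IsExecution F ρ S T) (hF : ∀ v, 0 ≤ F v)
    (hτ : Reliable F ρ S T τ) {v : ℕ} (hv : 0 < v) : ∃ l j, Enters F ρ S T l j v := by
  obtain ⟨t, -, h⟩ := hT.exists_forall_le_view hF hτ v
  obtain ⟨i, hi⟩ := S.correct_nonempty
  obtain ⟨l, -, h'⟩ := hT.exists_enters_of_le_view hv (Nat.le_of_succ_le (h i hi))
  exact ⟨l, h'⟩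

/-! ### First and last entries -/

/-- All correct processes enter a view with a long enough timeout within `2 * δ` of the first
one, if messages are reliable by then. -/
theorem IsExecution.enters_of_enters (hT : IsExecution F ρ S T) (hτ : Reliable F ρ S T τ) {v : ℕ}
    (hv : 0 < v) (hFv : 2 * S.δ < F v) {t : ℝ} (ht : τ ≤ t)
    (hE : ∀ k i, Enters F ρ S T k i v → t ≤ T.time k) {k₀ : ℕ} {p : Fin (3 * f + 1)}
    (h₀ : Enters F ρ S T k₀ p v) (ht₀ : T.time k₀ = t) {i : Fin (3 * f + 1)}
    (hi : i ∈ S.correct) : ∃ k, Enters F ρ S T k i v ∧ T.time k ≤ t + 2 * S.δ := by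
  have h1 := hT.le_view_of_enters hτ hv h₀ ht ht₀.le hi
  -- No correct process wishes above v before t + F(v), which is later than t + 2δ.
  have h2 : (state F ρ S T (eventsUpTo T (t + 2 * S.δ)) i).viewPlus < v + 1 := by
    by_contra! hc
    obtain ⟨j, l, hl, w, hw, hs⟩ := hT.exists_wished_of_le_viewPlus (by omega) hc
    have h3 := hT.add_le_time_of_sends hv (hτ.gst_le.trans ht) hE (show v < w by omega) hs
    have h4 := hT.lt_eventsUpTo_iff.1 (show l < eventsUpTo T (t + 2 * S.δ) by omega)
    linarith
  have h3 := view_le_viewPlus (F := F) (ρ := ρ) (S := S) (T := T) (eventsUpTo T (t + 2 * S.δ)) i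
  obtain ⟨l, hl, hE', -⟩ := hT.timer_spec _ i (hv.trans_le h1) (by omega)
  rw [show (state F ρ S T (eventsUpTo T (t + 2 * S.δ)) i).view = v by omega] at hE'
  exact ⟨l, hE', hT.lt_eventsUpTo_iff.1 hl⟩

/-- The infimum is attained at the entry with the least event number. -/
theorem IsExecution.exists_enters_tFirst (hT : IsExecution F ρ S T) {v : ℕ}
    (h : ∃ k i, Enters F ρ S T k i v) :
    (∃ k i, Enters F ρ S T k i v ∧ T.time k = tFirst F ρ S T v) ∧
      ∀ k i, Enters F ρ S T k i v → tFirst F ρ S T v ≤ T.time k := by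
  classical
  obtain ⟨i, hE⟩ := Nat.find_spec h
  have hL : IsLeast {t | ∃ i ∈ S.correct, ∃ k, Enters F ρ S T k i v ∧ T.time k = t}
      (T.time (Nat.find h)) := by
    refine ⟨⟨i, hT.mem_of_enters hE, _, hE, rfl⟩, ?_⟩
    rintro t ⟨j, -, k, hk, rfl⟩
    exact hT.time_mono (Nat.find_min' h ⟨j, hk⟩)
  have h1 : tFirst F ρ S T v = T.time (Nat.find h) := hL.csInf_eq
  exact ⟨⟨_, i, hE, h1.symm⟩, fun k j hk => h1 ▸ hT.time_mono (Nat.find_min' h ⟨j, hk⟩)⟩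

theorem IsExecution.tLast_le (hT : IsExecution F ρ S T) {v : ℕ} {t : ℝ}
    (hE : ∃ k i, Enters F ρ S T k i v)
    (h : ∀ i ∈ S.correct, v ≤ (state F ρ S T (eventsUpTo T t) i).view) :
    tLast F ρ S T v ≤ t := by
  obtain ⟨k, i, hk⟩ := hE
  refine csSup_le ⟨_, i, hT.mem_of_enters hk, k, hk, rfl⟩ ?_
  rintro _ ⟨j, hj, l, hl, rfl⟩
  exact hT.lt_eventsUpTo_iff.1 (hl.lt_of_le_view (h j hj))

/-- Once every correct process has reached v+1, no more entries into v occur; this bounds the set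
whose supremum is taken. -/
theorem IsExecution.time_le_tLast (hT : IsExecution F ρ S T) (hF : ∀ v, 0 ≤ F v)
    (hτ : Reliable F ρ S T τ) {v k : ℕ} {i : Fin (3 * f + 1)} (h : Enters F ρ S T k i v) :
    T.time k ≤ tLast F ρ S T v := by
  obtain ⟨t, -, ht⟩ := hT.exists_forall_le_view hF hτ v
  refine le_csSup ⟨t, ?_⟩ ⟨i, hT.mem_of_enters h, k, h, rfl⟩
  rintro _ ⟨j, hj, l, hl, rfl⟩
  exact hT.lt_eventsUpTo_iff.1 (hl.lt_of_le_view (Nat.le_of_succ_le (ht j hj)))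

/-! ### Strict order of entries in time -/

/-- Receiving a message from oneself again has no effect. -/
theorem lt_of_viewPlus_ne {k w : ℕ} {i : Fin (3 * f + 1)} (hp : T.proc k = i)
    (hA : T.act k = .recv i w)
    (h : (state F ρ S T (k + 1) i).view ≠ (state F ρ S T k i).view ∨
      (state F ρ S T (k + 1) i).viewPlus ≠ (state F ρ S T k i).viewPlus) :
    (state F ρ S T k i).maxViews i < w := by
  by_contra! hc
  have h1 := (recv_spec (F := F) (ρ := ρ) (S := S) hp hA).2.2.1
  rw [max_eq_left hc, Function.update_eq_self] at h1
  have := eq_of_maxViews_eq h1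
  tauto

theorem IsExecution.exists_sends_same_time (hT : IsExecution F ρ S T) {k w : ℕ}
    {i : Fin (3 * f + 1)} (hi : i ∈ S.correct) (hA : T.act k = .recv i w)
    (h : (state F ρ S T k i).maxViews i < w) :
    ∃ l < k, T.time l = T.time k ∧ Sends F ρ S T l i w := by
  obtain ⟨l, hl, hs⟩ := hT.recv_sent k i w hA hi
  refine ⟨l, hl, le_antisymm (hT.time_mono hl.le) ?_, hs⟩
  by_contra! hc
  exact h.not_ge (hT.self_le_maxViews hs hc)

/-- A new message from oneself is caused by another event at the same time. -/
theorem IsExecution.exists_cause (hT : IsExecution F ρ S T) {i : Fin (3 * f + 1)}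
    (hi : i ∈ S.correct) (k : ℕ) : ∀ w, T.act k = .recv i w →
    (state F ρ S T k i).maxViews i < w →
    ∃ e < k, T.proc e = i ∧ T.time e = T.time k ∧ ∀ v, T.act e ≠ .recv i v := by
  induction k using Nat.strong_induction_on with
  | _ k ih =>
    intro w hA h
    obtain ⟨l, hl, ht, hs⟩ := hT.exists_sends_same_time hi hA h
    by_cases hr : ∃ v, T.act l = .recv i v
    · obtain ⟨v, hv⟩ := hr
      have h1 := ((recv_spec hs.1 hv).2.2.2 w).1 hs
      obtain ⟨e, he, h2, h3, h4⟩ := ih l hl v hv (lt_of_viewPlus_ne hs.1 hv (.inr h1.2.ne'))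
      exact ⟨e, he.trans hl, h2, h3.trans ht, h4⟩
    · exact ⟨l, hl, hs.1, ht, fun v hv => hr ⟨v, hv⟩⟩

theorem IsExecution.time_lt_of_enters (hT : IsExecution F ρ S T) {i : Fin (3 * f + 1)}
    (hN : NoSimultaneous T i) {k k' v v' : ℕ} (h : Enters F ρ S T k i v)
    (h' : Enters F ρ S T k' i v') (hk : k < k') : T.time k < T.time k' := by
  by_contra! hc
  have hi := hT.mem_of_enters h
  obtain ⟨⟨j, w, hA⟩, hv1, hv2, hv3, -⟩ := h.spec
  -- an event other than the reception of an own message, at the same time as `k`, comes before `k`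
  have key : ∀ m > k, m ≤ k' → T.proc m = i → (∀ u, T.act m ≠ .recv i u) → False := by
    intro m hm hm' hp hr
    have ht : T.time m = T.time k := le_antisymm ((hT.time_mono hm').trans hc)
      (hT.time_mono (le_of_lt hm))
    by_cases hr' : ∃ u, T.act k = .recv i u
    · obtain ⟨u, hu⟩ := hr'
      obtain ⟨e, he, h1, h2, h3⟩ := hT.exists_cause hi k u hu
        (lt_of_viewPlus_ne (F := F) (ρ := ρ) (S := S) h.1 hu (.inl (by omega)))
      have := hN e m h1 hp h3 hr (h2.trans ht.symm)
      omega
    · have := hN k m h.1 hp (fun u hu => hr' ⟨u, hu⟩) hr ht.symm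
      omega
  have hvv : v < v' := (h.lt_iff h').2 hk
  -- Let `m` be the first event at which `view⁺` exceeds v; it lies in (k, k']. By `key` it can only
  -- be the reception of an own message, and tracing that message to its sending leads to a
  -- contradiction.
  have hex : ∃ m, v < (state F ρ S T (m + 1) i).viewPlus := ⟨k', by rw [h'.spec.2.2.2.1]; exact hvv⟩
  classical
  obtain ⟨m, hm1, hm2⟩ : ∃ m, v < (state F ρ S T (m + 1) i).viewPlus ∧
      ∀ l < m, (state F ρ S T (l + 1) i).viewPlus ≤ v :=
    ⟨Nat.find hex, Nat.find_spec hex, fun l hl => not_lt.1 (Nat.find_min hex hl)⟩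
  have hkm : k < m := by
    by_contra! hmk
    have := viewPlus_monotone (F := F) (ρ := ρ) (S := S) (T := T) i (Nat.succ_le_succ hmk)
    simp only [Nat.succ_eq_add_one] at this
    omega
  have hmk' : m ≤ k' := by
    by_contra! hmk
    have := hm2 k' hmk
    rw [h'.spec.2.2.2.1] at this
    omega
  have hm3 : (state F ρ S T m i).viewPlus ≤ v := by
    have := hm2 (m - 1) (by omega)
    rwa [Nat.sub_add_cancel (by omega)] at this
  have hp : T.proc m = i := by
    by_contra hp
    rw [state_succ_of_ne hp] at hm1
    omega
  by_cases hr : ∃ u, T.act m = .recv i u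
  · obtain ⟨u, hu⟩ := hr
    have h1 := lt_of_viewPlus_ne (F := F) (ρ := ρ) (S := S) hp hu (.inr (by omega))
    obtain ⟨l, hl, ht, hs⟩ := hT.exists_sends_same_time hi hu h1
    -- A single raised entry moved `view⁺` past v, so the received view itself is above v.
    have h2 : v < u := by
      have h3 := supportedView_update_le (c := f + 1) (w := u) (by omega)
        (state F ρ S T m i).maxViews i
      rw [← (recv_spec (F := F) (ρ := ρ) (S := S) hp hu).2.2.1, ← (view_eq_and_viewPlus_eq _ _).2,
        ← (view_eq_and_viewPlus_eq _ _).2] at h3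
      omega
    rcases hs.spec with h3 | ⟨h3, h4, h5, -⟩
    · have := hm2 l hl
      omega
    -- The wish u = `view` + 1 was sent without a reception. Before `k` the view is below v, so u ≤
    -- v; `k` itself is a reception; after `k`, `key` applies.
    · rcases lt_trichotomy l k with h6 | h6 | h6
      · have := view_monotone (F := F) (ρ := ρ) (S := S) (T := T) i h6.le
        simp only at this
        omega
      · subst h6
        exact h5 j w hA
      · exact key l h6 (by omega) hs.1 fun u => h5 i u
  · exact key m hkm hmk' hp fun u hu => hr ⟨u, hu⟩

/-! ### The specification from a reliable view on -/

/-- The synchronizer specification holds from `V` on, if `V` is entered only when messages are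
reliable, and its timeout is long enough. -/
theorem IsExecution.syncSpec (hT : IsExecution F ρ S T) (hF_mono : Monotone F)
    (hF : ∀ v, 0 ≤ F v) (hτ : Reliable F ρ S T τ) {V : ℕ} (hV : 1 ≤ V) (hFV : 2 * S.δ < F V)
    (hE : ∀ k i, Enters F ρ S T k i V → τ ≤ T.time k) :
    SyncSpec F ρ S T (2 * S.δ) V ∧
      ∀ v ≥ V, tLast F ρ S T (v + 1) ≤ tLast F ρ S T v + F v + S.δ := by
  have hex : ∀ v ≥ V, ∃ k i, Enters F ρ S T k i v := fun v hv =>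
    hT.exists_enters hF hτ (by omega)
  have hdur : ∀ v ≥ V, S.gst ≤ tFirst F ρ S T v →
      tFirst F ρ S T v + F v ≤ tFirst F ρ S T (v + 1) := by
    intro v hv hg
    obtain ⟨⟨k, i, hk, hkt⟩, -⟩ := hT.exists_enters_tFirst (hex (v + 1) (by omega))
    obtain ⟨j, l, hl, w, hw, hs⟩ := hT.exists_wished_of_le_viewPlus (by omega) hk.spec.2.2.2.1.ge
    have h1 := hT.add_le_time_of_sends (by omega) hg (hT.exists_enters_tFirst (hex v hv)).2
      (show v < w by omega) hs
    have := hT.time_mono (show l ≤ k by omega)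
    linarith
  have hfirst : ∀ v ≥ V, τ ≤ tFirst F ρ S T v := by
    intro v hv
    induction v, hv using Nat.le_induction with
    | base =>
      obtain ⟨⟨k, i, hk, hkt⟩, -⟩ := hT.exists_enters_tFirst (hex V le_rfl)
      exact hkt ▸ hE k i hk
    | succ v hv ih =>
      have h1 := hdur v hv (hτ.gst_le.trans ih)
      have h2 := hF v
      linarith
  have hall : ∀ v ≥ V, ∀ i ∈ S.correct,
      ∃ k, Enters F ρ S T k i v ∧ T.time k ≤ tFirst F ρ S T v + 2 * S.δ := by
    intro v hv i hi
    obtain ⟨⟨k, p, hk, hkt⟩, hmin⟩ := hT.exists_enters_tFirst (hex v hv)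
    exact hT.enters_of_enters hτ (by omega) (hFV.trans_le (hF_mono hv)) (hfirst v hv) hmin hk hkt hi
  refine ⟨⟨hV, ?_, ?_, hτ.gst_le.trans (hfirst V le_rfl), ?_, ?_, ?_⟩, ?_⟩
  · intro i _ k k' v v' h h'
    exact h.lt_iff h'
  · intro i _ hN k k' v v' h h'
    rw [h.lt_iff h']
    exact ⟨hT.time_lt_of_enters hN h h', fun ht => hT.time_mono.reflect_lt ht⟩
  · intro v hv i hi
    obtain ⟨k, hk, -⟩ := hall v hv i hi
    exact ⟨k, hk⟩
  · intro v hv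
    refine hT.tLast_le (hex v hv) fun i hi => ?_
    obtain ⟨k, hk, hkt⟩ := hall v hv i hi
    exact hk.le_view (hT.lt_eventsUpTo_iff.2 hkt)
  · intro v hv
    exact hdur v hv (hτ.gst_le.trans (hfirst v hv))
  · intro v hv
    have h1 : τ ≤ tLast F ρ S T v := by
      obtain ⟨k, i, hk⟩ := hex v hv
      exact (hfirst v hv).trans
        (((hT.exists_enters_tFirst (hex v hv)).2 k i hk).trans (hT.time_le_tLast hF hτ hk))
    refine hT.tLast_le (hex (v + 1) (by omega)) fun i hi => ?_
    refine hT.le_view_of_wished hτ (by linarith [hF v]) (by omega) (fun j hj => ?_) hi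
    refine hT.wished_succ_of_le_view hF (by omega) (hτ.gst_le.trans h1) hj ?_
    obtain ⟨k, hk, -⟩ := hall v hv j hj
    exact hk.le_view (hT.lt_eventsUpTo_iff.2 (hT.time_le_tLast hF hτ hk))

/-! ### Global view and start times -/

/-- Needed because the supremum of an unbounded set of naturals is 0 by convention. -/
theorem IsExecution.bddAbove_entered (hT : IsExecution F ρ S T) (i : Fin (3 * f + 1)) (t : ℝ) :
    BddAbove {v | ∃ k, Enters F ρ S T k i v ∧ T.time k ≤ t} := by
  refine ⟨(state F ρ S T (eventsUpTo T t) i).view, ?_⟩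
  rintro v ⟨k, hk, ht⟩
  exact hk.le_view (hT.lt_eventsUpTo_iff.2 ht)

theorem IsExecution.le_globalView (hT : IsExecution F ρ S T) {k v : ℕ} {i : Fin (3 * f + 1)}
    {t : ℝ} (h : Enters F ρ S T k i v) (ht : T.time k ≤ t) : v ≤ globalView F ρ S T t :=
  (le_csSup (hT.bddAbove_entered i t) ⟨k, h, ht⟩).trans
    (Finset.le_sup (f := fun i => localView F ρ S T i t) (hT.mem_of_enters h))

theorem IsExecution.exists_enters_globalView (hT : IsExecution F ρ S T) {t : ℝ}
    (h : 0 < globalView F ρ S T t) :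
    ∃ k i, Enters F ρ S T k i (globalView F ρ S T t) ∧ T.time k ≤ t := by
  obtain ⟨i, hi, hg⟩ := Finset.exists_mem_eq_sup _ S.correct_nonempty
    (fun i => localView F ρ S T i t)
  change globalView F ρ S T t = _ at hg
  rw [hg] at h ⊢
  have hne : {v | ∃ k, Enters F ρ S T k i v ∧ T.time k ≤ t}.Nonempty := by
    by_contra hc
    rw [Set.not_nonempty_iff_eq_empty] at hc
    simp [localView, hc] at h
  obtain ⟨k, hk⟩ := Nat.sSup_mem hne (hT.bddAbove_entered i t)
  exact ⟨k, i, hk⟩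

theorem IsExecution.startTimes_finite (hT : IsExecution F ρ S T) : (startTimes S T).Finite := by
  choose! st hst using fun i hi => hT.start_once i hi
  refine (S.correct.image fun i => T.time (st i)).finite_toSet.subset ?_
  rintro t ⟨i, hi, k, hp, hA, rfl⟩
  rw [(hst i hi).2 k ⟨hp, hA⟩]
  exact Finset.mem_coe.2 (Finset.mem_image_of_mem (fun i => T.time (st i)) hi)

theorem IsExecution.sFirst_le (hT : IsExecution F ρ S T) {k : ℕ} (h : T.act k = .start) :
    sFirst S T ≤ T.time k :=
  csInf_le hT.startTimes_finite.bddBelow ⟨_, hT.proc_correct k, k, rfl, h, rfl⟩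

theorem IsExecution.le_sLast (hT : IsExecution F ρ S T) {k : ℕ} (h : T.act k = .start) :
    T.time k ≤ sLast S T :=
  le_csSup hT.startTimes_finite.bddAbove ⟨_, hT.proc_correct k, k, rfl, h, rfl⟩

open Classical in
theorem IsExecution.card_wished_one (hT : IsExecution F ρ S T) {m : ℕ} (hm : m ≤ S.correct.card)
    {t : ℝ} (h : sKth S T m ≤ t) :
    m ≤ (S.correct.filter (fun i => Wished F ρ S T (eventsUpTo T t) i 1)).card := by
  have hne : {t | m ≤ (S.correct.filter
      (fun i => ∃ k, T.proc k = i ∧ T.act k = .start ∧ T.time k ≤ t)).card}.Nonempty := by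
    refine ⟨sLast S T, hm.trans (Finset.card_le_card fun i hi => Finset.mem_filter.2 ⟨hi, ?_⟩)⟩
    obtain ⟨k, hp, hA⟩ := (hT.start_once i hi).exists
    exact ⟨k, hp, hA, hT.le_sLast hA⟩
  -- Attainment of the infimum is not needed: some admissible s precedes the first event after t, so
  -- every start by time s happens before that event.
  obtain ⟨s, hs, hst⟩ := exists_lt_of_csInf_lt hne (h.trans_lt (hT.lt_time_eventsUpTo t))
  refine le_trans hs (Finset.card_le_card fun i hi => ?_)
  obtain ⟨hi, k, hp, hA, hk⟩ := Finset.mem_filter.1 hi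
  exact Finset.mem_filter.2 ⟨hi, (wished_one_of_start hp hA).mono
    (hT.time_mono.reflect_lt (hk.trans_lt hst)) le_rfl⟩

end FastSync

theorem mainTheorem1 (f : ℕ) (F : ℕ → ℝ) (hF_mono : Monotone F) (hF_zero : F 0 = 0)
    (hF_unbounded : ∀ θ : ℝ, ∃ v, ∀ v' ≥ v, θ < F v') (ρ : ℝ) (hρ : 0 < ρ)
    (S : FastSync.Env f) (T : FastSync.Trace f) (hT : FastSync.IsExecution F ρ S T) :
    (∃ V, FastSync.SyncSpec F ρ S T (2 * S.δ) V) ∧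
    (S.gst ≤ FastSync.sFirst S T → 2 * S.δ < F 1 →
      FastSync.SyncSpec F ρ S T (2 * S.δ) 1 ∧
      (∀ v ≥ 1, FastSync.tLast F ρ S T (v + 1) ≤ FastSync.tLast F ρ S T v + F v + S.δ) ∧
      FastSync.tLast F ρ S T 1 ≤ FastSync.sLast S T + S.δ) ∧
    (∀ V, V = FastSync.globalView F ρ S T (S.gst + ρ) + 1 →
      FastSync.sKth S T (f + 1) ≤ S.gst + ρ → 2 * S.δ < F V →
      FastSync.SyncSpec F ρ S T (2 * S.δ) V ∧
      (∀ v ≥ V, FastSync.tLast F ρ S T (v + 1) ≤ FastSync.tLast F ρ S T v + F v + S.δ) ∧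
      FastSync.tLast F ρ S T V ≤
        S.gst + ρ + F (FastSync.globalView F ρ S T (S.gst + ρ)) + 3 * S.δ) := by
  have hF : ∀ v, 0 ≤ F v := fun v => hF_zero ▸ hF_mono (Nat.zero_le v)
  have hδ := S.δ_pos
  have hτ := hT.reliable_add hρ
  have hlate : ∀ v, FastSync.globalView F ρ S T (S.gst + ρ) < v →
      ∀ k i, FastSync.Enters F ρ S T k i v → S.gst + ρ ≤ T.time k := by
    intro v hv k i hk
    by_contra! hc
    exact (hT.le_globalView hk hc.le).not_gt hv
  refine ⟨?_, ?_, ?_⟩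
  · obtain ⟨v, hv⟩ := hF_unbounded (2 * S.δ)
    have h1 := le_max_left v (FastSync.globalView F ρ S T (S.gst + ρ) + 1)
    have h2 := le_max_right v (FastSync.globalView F ρ S T (S.gst + ρ) + 1)
    exact ⟨_, (hT.syncSpec hF_mono hF hτ (by omega) (hv _ h1) (hlate _ (by omega))).1⟩
  · intro hS hF1
    have hstart : ∀ k, T.act k = .start → S.gst ≤ T.time k := fun k hA =>
      hS.trans (hT.sFirst_le hA)
    have hτ' := hT.reliable_gst hstart
    have hlate' : ∀ k i, FastSync.Enters F ρ S T k i 1 → S.gst ≤ T.time k := by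
      intro k i hk
      obtain ⟨j, l, hl, w, hw, hs⟩ :=
        hT.exists_wished_of_le_viewPlus (by omega) hk.spec.2.2.2.1.ge
      obtain ⟨l', hl', hA⟩ := hT.exists_start_of_sends l j w (by omega) hs
      exact (hstart l' hA).trans (hT.time_mono (by omega))
    obtain ⟨h1, h2⟩ := hT.syncSpec hF_mono hF hτ' le_rfl hF1 hlate'
    refine ⟨h1, h2, hT.tLast_le (hT.exists_enters hF hτ' one_pos) fun i hi => ?_⟩
    obtain ⟨k, -, hA⟩ := (hT.start_once i hi).exists
    refine hT.le_view_of_wished hτ' ((hstart k hA).trans (hT.le_sLast hA)) one_pos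
      (fun j hj => ?_) hi
    obtain ⟨l, hp, hA⟩ := (hT.start_once j hj).exists
    exact (FastSync.wished_one_of_start hp hA).mono
      (hT.lt_eventsUpTo_iff.2 (hT.le_sLast hA)) le_rfl
  · rintro V rfl hS hFV
    obtain ⟨h1, h2⟩ := hT.syncSpec hF_mono hF hτ (by omega) hFV (hlate _ (by omega))
    refine ⟨h1, h2, hT.tLast_le (hT.exists_enters hF hτ (by omega)) fun i hi => ?_⟩
    -- With no view entered by GST+ρ, the f+1 starts lift all processes to view 1 within 2δ.
    -- Otherwise the entered view g spreads within 2δ, its timers run out after F(g), and the wishes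
    -- for g+1 take another δ; this is the source of 3δ.
    rcases Nat.eq_zero_or_pos (FastSync.globalView F ρ S T (S.gst + ρ)) with h0 | h0
    · rw [h0, hF_zero]
      have hc := S.correct_card
      refine (hT.le_view_of_card_wished hτ le_rfl one_pos
        (hT.card_wished_one (by omega) hS) hi).trans
        (FastSync.view_monotone i (hT.eventsUpTo_mono (by linarith)))
    · obtain ⟨k, p, hk, hkt⟩ := hT.exists_enters_globalView h0
      have hFg := hF (FastSync.globalView F ρ S T (S.gst + ρ))
      have h3 := hT.le_view_of_wished hτ
        (t := S.gst + ρ + 2 * S.δ + F (FastSync.globalView F ρ S T (S.gst + ρ))) (by linarith)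
        (Nat.succ_pos (FastSync.globalView F ρ S T (S.gst + ρ)))
        (fun j hj => hT.wished_succ_of_le_view hF h0 (by linarith) hj
          (hT.le_view_of_enters hτ h0 hk le_rfl hkt hj)) hi
      exact h3.trans (FastSync.view_monotone i (hT.eventsUpTo_mono (by linarith)))
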